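/- Let $X$ be a finite set and let $Y=(X,\{R_i\}_{0\le i\le D})$ be a symmetric $D$-class association scheme: $R_0,\dots,R_D$ are nonempty symmetric relations partitioning $X\times X$, $R_0$ is the equality relation, and for all $h,i,j$ the number of $z\in X$ with $(x,z)\in R_i$ and $(z,y)\in R_j$ is the same for all $(x,y)\in R_h$. Let $A_0,\dots,A_D\in\mathrm{Mat}_X(\mathbb{C})$ be its associate matrices, i.e. $(A_i)_{xy}=1$ if $(x,y)\in R_i$ and $0$ otherwise, and let $E_0,\dots,E_D$ be an ordering of its primitive idempotents, i.e. of the basis of $\mathrm{span}(A_0,\dots,A_D)$ consisting of mutually orthogonal idempotents with sum $I$, where $E_0=|X|^{-1}J$ and $J$ is the all-ones matrix. Define the Krein parameters $q^h_{ij}$ by $E_i\circ E_j=|X|^{-1}\sum_{h=0}^D q^h_{ij}E_h$, where $\circ$ is the entrywise product, and assume that $Y$ is $Q$-polynomial with respect to the ordering $E_0,\dots,E_D$: for all $0\le h,i,j\le D$, $q^h_{ij}=0$ whenever one of $h,i,j$ is greater than the sum of the other two, and $q^h_{ij}\neq 0$ whenever one of $h,i,j$ equals the sum of the other two. For $x\in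 X$ let $E_i^*(x)$ be the diagonal matrix whose $(y,y)$ entry is $1$ if $(x,y)\in R_i$ and $0$ otherwise, and let the Terwilliger algebra $T(x)$ be the subalgebra of $\mathrm{Mat}_X(\mathbb{C})$ generated by $A_0,\dots,A_D,E_0^*(x),\dots,E_D^*(x)$. It acts on $V=\mathbb{C}^X$ by matrix multiplication; an irreducible $T(x)$-module is a nonzero $T(x)$-invariant subspace $W\subseteq V$ whose only $T(x)$-invariant subspaces are $0$ and $W$. Assume that $Y$ is dual thin: $\dim(E_iW)\le 1$ for all $0\le i\le D$, for every $x\in X$ and every irreducible $T(x)$-module $W$. Then the multiplicities $m_i=\operatorname{rank}E_i=\dim(E_iV)$ satisfy $$m_i\le m_{i+1}\quad\text{and}\quad m_i\le m_{D-i}$$ for all integers $i$ with $0\le i<D/2$. -/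

import Mathlib

open scoped Matrix

/-- A symmetric `D`-class association scheme on the finite set `X`: a partition of `X × X` into
nonempty symmetric relations `R 0, …, R D`, where `R 0` is equality, such that for all `h, i, j`
the number of `z` with `(x, z) ∈ R i` and `(z, y) ∈ R j` is the same for all `(x, y) ∈ R h`. -/
structure SymmAssocScheme (X : Type*) [Fintype X] (D : ℕ) where
  /-- the associate classes -/
  R : Fin (D + 1) → X → X → Prop
  R_nonempty : ∀ i, ∃ x y, R i x y
  R_partition : ∀ x y, ∃! i, R i x y
  R_zero : ∀ x y, R 0 x y ↔ x = y
  R_symm : ∀ i x y, R i x y → R i y x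
  R_regular : ∀ h i j, ∃ p : ℕ, ∀ x y, R h x y → {z | R i x z ∧ R j z y}.ncard = p

namespace SymmAssocScheme

variable {X : Type*} [Fintype X] {D : ℕ}

open Classical in
/-- The associate matrix `A i`: the `0`-`1` matrix of the relation `R i`. -/
noncomputable def assocMatrix (Y : SymmAssocScheme X D) (i : Fin (D + 1)) : Matrix X X ℂ :=
  Matrix.of fun x y => if Y.R i x y then 1 else 0

/-- The Bose–Mesner algebra, as the linear span of the associate matrices. -/
noncomputable def boseMesner (Y : SymmAssocScheme X D) : Submodule ℂ (Matrix X X ℂ) :=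
  Submodule.span ℂ (Set.range Y.assocMatrix)

open Classical in
/-- The dual idempotent `E*_i(x)`: the diagonal matrix whose `(y, y)` entry is `1` if
`(x, y) ∈ R i`, and `0` otherwise. -/
noncomputable def dualIdempotent (Y : SymmAssocScheme X D) (x : X) (i : Fin (D + 1)) :
    Matrix X X ℂ :=
  Matrix.diagonal fun y => if Y.R i x y then 1 else 0

variable [DecidableEq X]

/-- `E 0, …, E D` is an ordering of the primitive idempotents of the scheme: mutually orthogonal
nonzero idempotents with sum `1` which span the Bose–Mesner algebra (so they form a basis of it),
where, as usual, `E 0` is the matrix `|X|⁻¹ J` with all entries `|X|⁻¹`. -/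
structure IsPrimitiveIdempotents (Y : SymmAssocScheme X D)
    (E : Fin (D + 1) → Matrix X X ℂ) : Prop where
  complete : CompleteOrthogonalIdempotents E
  ne_zero : ∀ i, E i ≠ 0
  span_eq : Submodule.span ℂ (Set.range E) = Y.boseMesner
  zero_eq : E 0 = Matrix.of fun _ _ => (Fintype.card X : ℂ)⁻¹

/-- The numbers `q h i j` are the Krein parameters (dual intersection numbers) with respect to
`E 0, …, E D`: the entrywise product `E i ⊙ E j` equals `|X|⁻¹ ∑ h, q h i j • E h`. -/
def IsKreinParameters (E : Fin (D + 1) → Matrix X X ℂ)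
    (q : Fin (D + 1) → Fin (D + 1) → Fin (D + 1) → ℂ) : Prop :=
  ∀ i j, E i ⊙ E j = (Fintype.card X : ℂ)⁻¹ • ∑ h, q h i j • E h

/-- `Y` is `Q`-polynomial with respect to the ordering `E 0, …, E D` of its primitive idempotents:
`q h i j` is zero whenever one of `h, i, j` is greater than the sum of the other two, and nonzero
whenever one of `h, i, j` is equal to the sum of the other two. -/
def IsQPolynomial (Y : SymmAssocScheme X D) (E : Fin (D + 1) → Matrix X X ℂ) : Prop :=
  Y.IsPrimitiveIdempotents E ∧
    ∃ q : Fin (D + 1) → Fin (D + 1) → Fin (D + 1) → ℂ, IsKreinParameters E q ∧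
      ∀ h i j : Fin (D + 1),
        (((h : ℕ) > i + j ∨ (i : ℕ) > h + j ∨ (j : ℕ) > h + i) → q h i j = 0) ∧
        (((h : ℕ) = i + j ∨ (i : ℕ) = h + j ∨ (j : ℕ) = h + i) → q h i j ≠ 0)

/-- The Terwilliger algebra `T(x)`, generated by the associate matrices and the dual idempotents
with respect to `x`. -/
noncomputable def terwilligerAlgebra (Y : SymmAssocScheme X D) (x : X) :
    Subalgebra ℂ (Matrix X X ℂ) :=
  Algebra.adjoin ℂ (Set.range Y.assocMatrix ∪ Set.range (Y.dualIdempotent x))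

/-- A `T(x)`-module: a subspace of `ℂ^X` which is invariant under the Terwilliger algebra. -/
def IsTModule (Y : SymmAssocScheme X D) (x : X) (W : Submodule ℂ (X → ℂ)) : Prop :=
  ∀ B ∈ Y.terwilligerAlgebra x, ∀ w ∈ W, B *ᵥ w ∈ W

/-- An irreducible `T(x)`-module: it is nonzero, and its only submodules are `0` and itself. -/
def IsIrreducibleTModule (Y : SymmAssocScheme X D) (x : X) (W : Submodule ℂ (X → ℂ)) : Prop :=
  Y.IsTModule x W ∧ W ≠ ⊥ ∧ ∀ U ≤ W, Y.IsTModule x U → U = ⊥ ∨ U = W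

/-- `Y` is dual thin: `dim (E i W) ≤ 1` for every vertex `x`, every irreducible `T(x)`-module `W`
and every `i`. -/
def IsDualThin (Y : SymmAssocScheme X D) (E : Fin (D + 1) → Matrix X X ℂ) : Prop :=
  ∀ (x : X) (W : Submodule ℂ (X → ℂ)), Y.IsIrreducibleTModule x W →
    ∀ i, Module.finrank ℂ (W.map (Matrix.toLin' (E i))) ≤ 1

end SymmAssocScheme

/-- The multiplicity `m_i`: the rank of `E i`, that is, the dimension of `E i V`, `V = ℂ^X`. -/
noncomputable def schemeMultiplicity {X : Type*} [Fintype X] {D : ℕ}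
    (E : Fin (D + 1) → Matrix X X ℂ) (i : Fin (D + 1)) : ℕ :=
  (E i).rank

/-! Fix one vertex `x`. The algebra `T(x)` is closed under adjoints, so `V` is a direct sum of
irreducible `T(x)`-modules, and `m_i` is the sum of `dim E_i W` over them (`finrank_map_le`). By
dual thinness these dimensions are 0 or 1, so it suffices that `E_i W ≠ 0` forces `E_k W ≠ 0`
whenever `i < k ≤ D - i`.

Two facts give this: the support `{k | E_k W ≠ 0}` reaches some index at least `D - i`
(`exists_ge_mulVec_ne_zero`), and it has no gaps (`exists_mulVec_ne_zero_of_between`). Both rest on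
the vanishing of `E_h (E_i V ∘ E_j V)` when `q h i j = 0` (`mulVec_mul_eq_zero`); the first also
needs that `E_D` has no zero entry. -/

open Matrix
open scoped ComplexOrder

namespace SymmAssocScheme

/-! ### The Bose–Mesner algebra and its entrywise structure -/

section Scheme

variable {X : Type*} [Fintype X] {D : ℕ}

theorem nonempty (Y : SymmAssocScheme X D) : Nonempty X := by
  obtain ⟨x, -, -⟩ := Y.R_nonempty 0
  exact ⟨x⟩

variable (Y : SymmAssocScheme X D)

theorem assocMatrix_conjTranspose (i : Fin (D + 1)) :
    (Y.assocMatrix i)ᴴ = Y.assocMatrix i := by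
  classical
  ext x y
  have : Y.R i y x ↔ Y.R i x y := ⟨Y.R_symm i y x, Y.R_symm i x y⟩
  by_cases h : Y.R i x y <;> simp [assocMatrix, this, h]

theorem assocMatrix_transpose (i : Fin (D + 1)) :
    (Y.assocMatrix i)ᵀ = Y.assocMatrix i := by
  classical
  ext x y
  have : Y.R i y x ↔ Y.R i x y := ⟨Y.R_symm i y x, Y.R_symm i x y⟩
  simp [assocMatrix, this]

variable {Y}

theorem transpose_eq_of_mem_boseMesner {B : Matrix X X ℂ} (hB : B ∈ Y.boseMesner) : Bᵀ = B := by
  induction hB using Submodule.span_induction with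
  | mem B hB =>
    obtain ⟨i, rfl⟩ := hB
    exact Y.assocMatrix_transpose i
  | zero => simp
  | add B C _ _ hB hC => rw [transpose_add, hB, hC]
  | smul c B _ hB => rw [transpose_smul, hB]

theorem conjTranspose_mem_boseMesner {B : Matrix X X ℂ} (hB : B ∈ Y.boseMesner) :
    Bᴴ ∈ Y.boseMesner := by
  induction hB using Submodule.span_induction with
  | mem B hB =>
    obtain ⟨i, rfl⟩ := hB
    rw [Y.assocMatrix_conjTranspose i]
    exact Submodule.subset_span ⟨i, rfl⟩
  | zero => simp
  | add B C _ _ hB hC => rw [conjTranspose_add]; exact add_mem hB hC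
  | smul c B _ hB => rw [conjTranspose_smul]; exact Submodule.smul_mem _ _ hB

theorem apply_eq_of_mem_boseMesner {B : Matrix X X ℂ} (hB : B ∈ Y.boseMesner)
    {j : Fin (D + 1)} {x y x' y' : X} (h : Y.R j x y) (h' : Y.R j x' y') : B x y = B x' y' := by
  classical
  induction hB using Submodule.span_induction with
  | mem B hB =>
    obtain ⟨i, rfl⟩ := hB
    have : Y.R i x y ↔ Y.R i x' y' := by
      constructor
      · intro hi
        rwa [(Y.R_partition x y).unique hi h]
      · intro hi
        rwa [(Y.R_partition x' y').unique hi h']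
    simp [assocMatrix, this]
  | zero => simp
  | add B C _ _ hB hC => rw [Matrix.add_apply, Matrix.add_apply, hB, hC]
  | smul c B _ hB => rw [Matrix.smul_apply, Matrix.smul_apply, hB]

theorem assocMatrix_hadamard {B : Matrix X X ℂ} (hB : B ∈ Y.boseMesner)
    {j : Fin (D + 1)} {x y : X} (h : Y.R j x y) :
    B ⊙ Y.assocMatrix j = B x y • Y.assocMatrix j := by
  classical
  ext x' y'
  by_cases h' : Y.R j x' y'
  · simp [assocMatrix, h', apply_eq_of_mem_boseMesner hB h' h]
  · simp [assocMatrix, h']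

theorem assocMatrix_ne_zero (j : Fin (D + 1)) : Y.assocMatrix j ≠ 0 := by
  classical
  obtain ⟨x, y, h⟩ := Y.R_nonempty j
  intro h0
  have := congrFun (congrFun h0 x) y
  simp [assocMatrix, h] at this

theorem dualIdempotent_mulVec (x : X) (j : Fin (D + 1)) (w : X → ℂ) :
    Y.dualIdempotent x j *ᵥ w = Y.assocMatrix j x * w := by
  classical
  ext y
  simp [dualIdempotent, assocMatrix, mulVec_diagonal]

end Scheme

/-! ### Primitive idempotents and Krein parameters -/

section Idempotents

variable {X : Type*} [Fintype X] [DecidableEq X] {D : ℕ} {Y : SymmAssocScheme X D}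
  {E : Fin (D + 1) → Matrix X X ℂ}

namespace IsPrimitiveIdempotents

variable (hE : Y.IsPrimitiveIdempotents E)
include hE

theorem mem_boseMesner (i : Fin (D + 1)) : E i ∈ Y.boseMesner :=
  hE.span_eq ▸ Submodule.subset_span ⟨i, rfl⟩

theorem exists_coeff {B : Matrix X X ℂ} (hB : B ∈ Y.boseMesner) :
    ∃ c : Fin (D + 1) → ℂ, ∑ i, c i • E i = B := by
  rw [← hE.span_eq] at hB
  exact (Submodule.mem_span_range_iff_exists_fun ℂ).1 hB

theorem mul_self (i : Fin (D + 1)) : E i * E i = E i := hE.complete.idem i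

theorem mul_of_ne {i j : Fin (D + 1)} (h : i ≠ j) : E i * E j = 0 := hE.complete.ortho h

theorem sum_smul_mul (c : Fin (D + 1) → ℂ) (h : Fin (D + 1)) :
    (∑ i, c i • E i) * E h = c h • E h := by
  rw [Finset.sum_mul, Finset.sum_eq_single h]
  · rw [smul_mul_assoc, hE.mul_self]
  · intro i _ hi
    rw [smul_mul_assoc, hE.mul_of_ne hi, smul_zero]
  · simp

theorem mul_sum_smul (c : Fin (D + 1) → ℂ) (h : Fin (D + 1)) :
    E h * (∑ i, c i • E i) = c h • E h := by
  rw [Finset.mul_sum, Finset.sum_eq_single h]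
  · rw [mul_smul_comm, hE.mul_self]
  · intro i _ hi
    rw [mul_smul_comm, hE.mul_of_ne hi.symm, smul_zero]
  · simp

theorem transpose_eq (i : Fin (D + 1)) : (E i)ᵀ = E i :=
  transpose_eq_of_mem_boseMesner (hE.mem_boseMesner i)

/-- The Bose–Mesner algebra is closed under adjoints, so `(E i)ᴴ * E i` is a multiple of `E i`,
nonzero because `E i ≠ 0`. Being Hermitian and a multiple of an idempotent, it pins down `E i` as
Hermitian. -/
theorem conjTranspose_eq (i : Fin (D + 1)) : (E i)ᴴ = E i := by
  obtain ⟨c, hc⟩ := hE.exists_coeff (conjTranspose_mem_boseMesner (hE.mem_boseMesner i))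
  have h1 : (E i)ᴴ * E i = c i • E i := by rw [← hc, hE.sum_smul_mul]
  have hci : c i ≠ 0 := by
    intro h0
    rw [h0, zero_smul] at h1
    exact hE.ne_zero i (conjTranspose_mul_self_eq_zero.1 h1)
  have h2 : (E i)ᴴ * E i = star (c i) • (E i)ᴴ := by
    rw [← conjTranspose_smul, ← h1, conjTranspose_mul, conjTranspose_conjTranspose]
  have hs : star (c i) ≠ 0 := star_ne_zero.2 hci
  have h3 : (E i)ᴴ * E i = (E i)ᴴ := by
    have h4 : ((E i)ᴴ * E i) * E i = (E i)ᴴ * E i := by rw [mul_assoc, hE.mul_self]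
    rw [h2, smul_mul_assoc] at h4
    exact smul_right_injective _ hs h4
  have h5 := congrArg conjTranspose h3
  rw [conjTranspose_mul, conjTranspose_conjTranspose, h3] at h5
  exact h5

theorem star_apply (i : Fin (D + 1)) (x y : X) : star (E i x y) = E i x y := by
  have h := congrFun (congrFun (hE.conjTranspose_eq i) y) x
  rw [conjTranspose_apply] at h
  rw [h, ← transpose_apply (E i), hE.transpose_eq]

theorem mulVec_star (i : Fin (D + 1)) (w : X → ℂ) : E i *ᵥ star w = star (E i *ᵥ w) := by
  rw [star_mulVec, hE.conjTranspose_eq, ← mulVec_transpose, hE.transpose_eq]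

theorem sum_mulVec (w : X → ℂ) : ∑ i, E i *ᵥ w = w := by
  rw [← Matrix.sum_mulVec, hE.complete.complete, one_mulVec]

theorem trace_ne_zero (i : Fin (D + 1)) : (E i).trace ≠ 0 := by
  intro h
  rw [← hE.mul_self i] at h
  nth_rewrite 2 [← hE.conjTranspose_eq i] at h
  exact hE.ne_zero i (trace_mul_conjTranspose_self_eq_zero_iff.1 h)

theorem mem_terwilligerAlgebra (x : X) (i : Fin (D + 1)) : E i ∈ Y.terwilligerAlgebra x := by
  have h : Y.boseMesner ≤ Subalgebra.toSubmodule (Y.terwilligerAlgebra x) := by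
    refine Submodule.span_le.2 ?_
    rintro _ ⟨j, rfl⟩
    exact Algebra.subset_adjoin (Or.inl ⟨j, rfl⟩)
  exact h (hE.mem_boseMesner i)

variable {q : Fin (D + 1) → Fin (D + 1) → Fin (D + 1) → ℂ} (hq : IsKreinParameters E q)
include hq

theorem hadamard_mul (h i j : Fin (D + 1)) :
    (E i ⊙ E j) * E h = ((Fintype.card X : ℂ)⁻¹ * q h i j) • E h := by
  rw [hq i j, smul_mul_assoc, hE.sum_smul_mul, smul_smul]

/-- If `q h i j = 0` then `E h` annihilates the entrywise product of `E i V` and `E j V`. -/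
theorem mulVec_mul_eq_zero {h i j : Fin (D + 1)} (h0 : q h i j = 0) (u v : X → ℂ) :
    E h *ᵥ ((E i *ᵥ u) * (E j *ᵥ v)) = 0 := by
  -- With `B_s` this matrix, `∑ B_s B_sᴴ = E_h (E_i ∘ E_j) E_h`, a multiple of `q h i j`. The traces
  -- of the summands are nonnegative, so every `B_s` vanishes.
  have key : ∀ s, E h * diagonal (fun y => E i y s) * E j = 0 := by
    have hsum : ∑ s, (E h * diagonal (fun y => E i y s) * E j) *
        (E h * diagonal (fun y => E i y s) * E j)ᴴ = 0 := by
      have h1 : ∀ s, (E h * diagonal (fun y => E i y s) * E j) *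
          (E h * diagonal (fun y => E i y s) * E j)ᴴ =
          E h * (diagonal (fun y => E i y s) * E j * diagonal (fun y => E i y s)) * E h := by
        intro s
        have hd : (diagonal (fun y => E i y s))ᴴ = diagonal (fun y => E i y s) := by
          rw [diagonal_conjTranspose]
          congr 1
          ext y
          exact hE.star_apply i y s
        rw [conjTranspose_mul, conjTranspose_mul, hE.conjTranspose_eq, hE.conjTranspose_eq, hd]
        calc _ = E h * (diagonal (fun y => E i y s) * (E j * E j) *
              diagonal (fun y => E i y s)) * E h := by simp only [mul_assoc]
          _ = _ := by rw [hE.mul_self]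
      have h2 : ∑ s, diagonal (fun y => E i y s) * E j * diagonal (fun y => E i y s) =
          E i ⊙ E j := by
        ext y z
        rw [Matrix.sum_apply]
        simp only [mul_diagonal, diagonal_mul, hadamard_apply]
        have h3 : E i y z = ∑ s, E i y s * E i z s := by
          conv_lhs => rw [← hE.mul_self i, mul_apply]
          refine Finset.sum_congr rfl fun s _ => ?_
          rw [← transpose_apply (E i) s z, hE.transpose_eq]
        rw [h3, Finset.sum_mul]
        exact Finset.sum_congr rfl fun s _ => by ring
      rw [Finset.sum_congr rfl fun s _ => h1 s, ← Finset.sum_mul, ← Finset.mul_sum, h2, mul_assoc,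
        hE.hadamard_mul hq, h0, mul_zero, zero_smul, mul_zero]
    have htr := congrArg trace hsum
    rw [trace_sum, trace_zero, Finset.sum_eq_zero_iff_of_nonneg] at htr
    · intro s
      exact trace_mul_conjTranspose_self_eq_zero_iff.1 (htr s (Finset.mem_univ s))
    · intro s _
      exact (posSemidef_self_mul_conjTranspose _).trace_nonneg
  have h4 : (E i *ᵥ u) * (E j *ᵥ v) =
      ∑ s, u s • (diagonal (fun y => E i y s) *ᵥ (E j *ᵥ v)) := by
    ext y
    simp only [Pi.mul_apply, Finset.sum_apply, Pi.smul_apply, mulVec_diagonal, smul_eq_mul]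
    rw [mulVec, dotProduct, Finset.sum_mul]
    exact Finset.sum_congr rfl fun s _ => by ring
  rw [h4, mulVec_sum]
  refine Finset.sum_eq_zero fun s _ => ?_
  rw [mulVec_smul, mulVec_mulVec, mulVec_mulVec, key, zero_mulVec, smul_zero]

end IsPrimitiveIdempotents

/-! ### Consequences of the Q-polynomial property -/

section QPolynomial

variable {q : Fin (D + 1) → Fin (D + 1) → Fin (D + 1) → ℂ}

/-- No entry of the last primitive idempotent of a `Q`-polynomial scheme vanishes. -/
theorem IsPrimitiveIdempotents.last_apply_ne_zero (hE : Y.IsPrimitiveIdempotents E)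
    (hq : IsKreinParameters E q) (hD : 0 < D)
    (hzero : ∀ h i : Fin (D + 1), (h : ℕ) > i + 1 → q h i ⟨1, by omega⟩ = 0)
    (hne : ∀ h i : Fin (D + 1), (h : ℕ) = i + 1 → q h i ⟨1, by omega⟩ ≠ 0)
    (x y : X) : E (Fin.last D) x y ≠ 0 := by
  have hX : (Fintype.card X : ℂ) ≠ 0 := by
    have := Y.nonempty
    exact_mod_cast Fintype.card_ne_zero
  obtain ⟨j, hj, -⟩ := Y.R_partition x y
  obtain ⟨c, hc⟩ := hE.exists_coeff (B := Y.assocMatrix j) (Submodule.subset_span ⟨j, rfl⟩)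
  -- Coefficients of `E h` in `A_j ∘ E_1 = E_1(x,y) A_j`.
  have hrec : ∀ h, ∑ i, c i * ((Fintype.card X : ℂ)⁻¹ * q h i ⟨1, by omega⟩) =
      E ⟨1, by omega⟩ x y * c h := by
    intro h
    have h1 := assocMatrix_hadamard (hE.mem_boseMesner ⟨1, by omega⟩) hj
    rw [hadamard_comm, ← hc] at h1
    have h2 := congrArg (· * E h) h1
    have h3 : (∑ i, c i • E i) ⊙ E ⟨1, by omega⟩ = ∑ i, c i • (E i ⊙ E ⟨1, by omega⟩) := by
      ext a b
      simp only [hadamard_apply, Matrix.sum_apply, Matrix.smul_apply, Finset.sum_mul, smul_eq_mul,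
        mul_assoc]
    simp only [h3, Finset.sum_mul, smul_mul_assoc, hE.hadamard_mul hq, smul_smul] at h2
    have h4 := hE.sum_smul_mul c h
    simp only [Finset.sum_mul, smul_mul_assoc] at h4
    rw [← Finset.sum_smul, h4, smul_smul] at h2
    exact smul_left_injective ℂ (hE.ne_zero h) h2
  have hcD : c (Fin.last D) ≠ 0 := by
    intro h0
    -- Downward induction from `D`: the recurrence at `k + 1` involves only `c i` with `i ≥ k`, and
    -- `c k` has a nonzero coefficient.
    have hall : ∀ m : ℕ, ∀ k : Fin (D + 1), D ≤ k + m → c k = 0 := by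
      intro m
      induction m with
      | zero =>
        intro k hk
        have : k = Fin.last D := Fin.ext (by have := k.2; simp; omega)
        rw [this, h0]
      | succ m ih =>
        intro k hk
        by_cases hkm : D ≤ k + m
        · exact ih k hkm
        have hlt : (k : ℕ) + 1 < D + 1 := by omega
        have h1 := hrec ⟨k + 1, hlt⟩
        rw [ih ⟨k + 1, hlt⟩ (by simp; omega), mul_zero, Finset.sum_eq_single k] at h1
        · have h2 := hne ⟨k + 1, hlt⟩ k rfl
          simpa [hX, h2] using h1
        · intro i _ hi
          rcases lt_or_gt_of_ne (Fin.val_ne_of_ne hi) with hlt' | hgt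
          · rw [hzero _ _ (by simp; omega), mul_zero, mul_zero]
          · rw [ih i (by omega), zero_mul]
        · simp
    refine assocMatrix_ne_zero (Y := Y) j ?_
    rw [← hc]
    exact Finset.sum_eq_zero fun i _ => by rw [hall D i (by omega), zero_smul]
  intro h0
  -- If `E_D` vanished at `(x, y)`, it would vanish on all of `R_j`, making `tr (A_j E_D)` zero; but
  -- this trace is `c_D tr E_D`.
  have h1 : Y.assocMatrix j * E (Fin.last D) = c (Fin.last D) • E (Fin.last D) := by
    rw [← hc, hE.sum_smul_mul]
  have h2 := assocMatrix_hadamard (hE.mem_boseMesner (Fin.last D)) hj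
  rw [h0, zero_smul] at h2
  have h3 : (Y.assocMatrix j * E (Fin.last D)).trace = 0 := by
    rw [trace]
    refine Finset.sum_eq_zero fun a _ => ?_
    rw [diag_apply, mul_apply]
    refine Finset.sum_eq_zero fun b _ => ?_
    have h4 := congrFun (congrFun h2 a) b
    rw [hadamard_apply, ← transpose_apply (E _), hE.transpose_eq] at h4
    rw [mul_comm]
    exact h4
  rw [h1, trace_smul, smul_eq_mul] at h3
  exact mul_ne_zero hcD (hE.trace_ne_zero _) h3

/-- The dual Bose–Mesner algebra of a `Q`-polynomial scheme is generated by `E 1`. -/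
theorem IsPrimitiveIdempotents.assocMatrix_row_mem (hE : Y.IsPrimitiveIdempotents E)
    (hq : IsKreinParameters E q) (hD : 0 < D)
    (hzero : ∀ h i : Fin (D + 1), (h : ℕ) > i + 1 → q h i ⟨1, by omega⟩ = 0)
    (hne : ∀ h i : Fin (D + 1), (h : ℕ) = i + 1 → q h i ⟨1, by omega⟩ ≠ 0)
    (x : X) (S : Submodule ℂ (X → ℂ)) (hone : 1 ∈ S)
    (hmul : ∀ f ∈ S, E ⟨1, by omega⟩ x * f ∈ S) (j : Fin (D + 1)) : Y.assocMatrix j x ∈ S := by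
  have hX : (Fintype.card X : ℂ) ≠ 0 := by
    have := Y.nonempty
    exact_mod_cast Fintype.card_ne_zero
  have hmem : ∀ m : ℕ, ∀ k : Fin (D + 1), (k : ℕ) ≤ m → E k x ∈ S := by
    intro m
    induction m with
    | zero =>
      intro k hk
      have hk0 : k = 0 := Fin.ext (by simpa using hk)
      have h1 : E k x = (Fintype.card X : ℂ)⁻¹ • (1 : X → ℂ) := by
        ext y
        simp [hk0, hE.zero_eq]
      rw [h1]
      exact S.smul_mem _ hone
    | succ m ih =>
      intro k hk
      by_cases hkm : (k : ℕ) ≤ m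
      · exact ih k hkm
      have hkk : (k : ℕ) = m + 1 := by omega
      have hm : m < D + 1 := by omega
      -- The terms above `m + 1` vanish and that at `m + 1` has a nonzero coefficient, so row `m +
      -- 1` can be solved for.
      have h1 : E ⟨1, by omega⟩ x * E ⟨m, hm⟩ x =
          ∑ h, ((Fintype.card X : ℂ)⁻¹ * q h ⟨m, hm⟩ ⟨1, by omega⟩) • E h x := by
        ext y
        have h2 := congrFun (congrFun (hq ⟨m, hm⟩ ⟨1, by omega⟩) x) y
        rw [hadamard_apply, Matrix.smul_apply, Matrix.sum_apply] at h2
        rw [Pi.mul_apply, mul_comm, h2, Finset.sum_apply, Finset.smul_sum]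
        simp [mul_assoc]
      have h3 := hmul _ (ih ⟨m, hm⟩ le_rfl)
      rw [h1, ← Finset.add_sum_erase _ _ (Finset.mem_univ k)] at h3
      have h4 : ∑ h ∈ Finset.univ.erase k,
          ((Fintype.card X : ℂ)⁻¹ * q h ⟨m, hm⟩ ⟨1, by omega⟩) • E h x ∈ S := by
        refine S.sum_mem fun h hh => ?_
        rcases lt_or_gt_of_ne (Fin.val_ne_of_ne (Finset.ne_of_mem_erase hh)) with hlt | hgt
        · exact S.smul_mem _ (ih h (by omega))
        · rw [hzero h ⟨m, hm⟩ (by simp; omega), mul_zero, zero_smul]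
          exact S.zero_mem
      have h5 := (S.add_mem_iff_left h4).1 h3
      exact (S.smul_mem_iff (mul_ne_zero (inv_ne_zero hX) (hne k ⟨m, hm⟩ hkk))).1 h5
  obtain ⟨c, hc⟩ := hE.exists_coeff (B := Y.assocMatrix j) (Submodule.subset_span ⟨j, rfl⟩)
  have h6 : Y.assocMatrix j x = ∑ i, c i • E i x := by
    ext y
    rw [← hc, Matrix.sum_apply, Finset.sum_apply]
    rfl
  rw [h6]
  exact S.sum_mem fun i _ => S.smul_mem _ (hmem i i le_rfl)

end QPolynomial

/-! ### Terwilliger modules: complete reducibility and supports -/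

section Modules

theorem isTModule_of_generators {x : X} {W : Submodule ℂ (X → ℂ)}
    (hA : ∀ j, ∀ w ∈ W, Y.assocMatrix j *ᵥ w ∈ W)
    (hA' : ∀ j, ∀ w ∈ W, Y.dualIdempotent x j *ᵥ w ∈ W) : Y.IsTModule x W := by
  intro B hB
  induction hB using Algebra.adjoin_induction with
  | mem B hB =>
    rcases hB with ⟨j, rfl⟩ | ⟨j, rfl⟩
    · exact hA j
    · exact hA' j
  | algebraMap c =>
    intro w hw
    rw [Algebra.algebraMap_eq_smul_one, smul_mulVec, one_mulVec]
    exact W.smul_mem _ hw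
  | add B C _ _ hB hC =>
    intro w hw
    rw [add_mulVec]
    exact W.add_mem (hB w hw) (hC w hw)
  | mul B C _ _ hB hC =>
    intro w hw
    rw [← mulVec_mulVec]
    exact hB _ (hC w hw)

/-- The generators are Hermitian. This closure makes the orthogonal complement of a module a module.
-/
theorem conjTranspose_mem_terwilligerAlgebra {x : X} {B : Matrix X X ℂ}
    (hB : B ∈ Y.terwilligerAlgebra x) : Bᴴ ∈ Y.terwilligerAlgebra x := by
  classical
  induction hB using Algebra.adjoin_induction with
  | mem B hB =>
    rcases hB with ⟨j, rfl⟩ | ⟨j, rfl⟩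
    · rw [Y.assocMatrix_conjTranspose j]
      exact Algebra.subset_adjoin (Or.inl ⟨j, rfl⟩)
    · have h : (Y.dualIdempotent x j)ᴴ = Y.dualIdempotent x j := by
        ext y z
        by_cases hyz : y = z
        · subst hyz
          by_cases hy : Y.R j x y <;> simp [dualIdempotent, hy]
        · simp [dualIdempotent, diagonal, hyz, Ne.symm hyz]
      rw [h]
      exact Algebra.subset_adjoin (Or.inr ⟨j, rfl⟩)
  | algebraMap c =>
    rw [Algebra.algebraMap_eq_smul_one, conjTranspose_smul, conjTranspose_one]
    exact Subalgebra.smul_mem _ (one_mem _) _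
  | add B C _ _ hB hC => rw [conjTranspose_add]; exact add_mem hB hC
  | mul B C _ _ hB hC => rw [conjTranspose_mul]; exact mul_mem hC hB

/-- Every `T(x)`-module has a complementary `T(x)`-module. -/
theorem IsTModule.exists_isCompl {x : X} {W : Submodule ℂ (X → ℂ)} (hW : Y.IsTModule x W) :
    ∃ W' : Submodule ℂ (X → ℂ), Y.IsTModule x W' ∧ IsCompl W W' := by
  let e : EuclideanSpace ℂ X ≃ₗ[ℂ] (X → ℂ) := WithLp.linearEquiv 2 ℂ (X → ℂ)
  let K : Submodule ℂ (EuclideanSpace ℂ X) := W.comap e.toLinearMap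
  have hK : K.map e.toLinearMap = W := Submodule.map_comap_eq_of_surjective e.surjective W
  refine ⟨Kᗮ.map e.toLinearMap, ?_, ?_⟩
  · intro B hB w hw
    obtain ⟨v, hv, rfl⟩ := hw
    refine ⟨e.symm (B *ᵥ e v), ?_, e.apply_symm_apply _⟩
    rw [SetLike.mem_coe, Submodule.mem_orthogonal] at hv ⊢
    intro u hu
    have h1 := hv (e.symm (Bᴴ *ᵥ e u))
      (by
        change e (e.symm _) ∈ W
        rw [e.apply_symm_apply]
        exact hW _ (conjTranspose_mem_terwilligerAlgebra hB) _ hu)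
    rw [EuclideanSpace.inner_eq_star_dotProduct] at h1 ⊢
    change (e v) ⬝ᵥ star (Bᴴ *ᵥ e u) = 0 at h1
    change (B *ᵥ e v) ⬝ᵥ star (e u) = 0
    rw [star_mulVec, conjTranspose_conjTranspose, dotProduct_comm, ← dotProduct_mulVec,
      dotProduct_comm] at h1
    exact h1
  · have h := (Submodule.isCompl_orthogonal (K := K)).map
      (Submodule.orderIsoMapComap e)
    rw [← hK]
    exact h

theorem exists_isIrreducibleTModule_le {x : X} {U : Submodule ℂ (X → ℂ)} (hU : Y.IsTModule x U)
    (hne : U ≠ ⊥) : ∃ W ≤ U, Y.IsIrreducibleTModule x W := by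
  obtain ⟨W, ⟨hWT, hW0, hWU⟩, hmin⟩ := wellFounded_lt.has_min
    {W : Submodule ℂ (X → ℂ) | Y.IsTModule x W ∧ W ≠ ⊥ ∧ W ≤ U} ⟨U, hU, hne, le_rfl⟩
  refine ⟨W, hWU, hWT, hW0, fun W' hle hT => ?_⟩
  by_contra! hcon
  exact hmin W' ⟨hT, hcon.1, hle.trans hWU⟩ (lt_of_le_of_ne hle hcon.2)

/-- Invariance keeps the two images inside `U` and `W`, hence disjoint. -/
theorem finrank_map_sup {K V : Type*} [Field K] [AddCommGroup V] [Module K V]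
    [FiniteDimensional K V] (f : V →ₗ[K] V) {U W : Submodule K V} (hU : U.map f ≤ U)
    (hW : W.map f ≤ W) (h : Disjoint U W) :
    Module.finrank K ((U ⊔ W).map f) = Module.finrank K (U.map f) + Module.finrank K (W.map f) := by
  have hd : U.map f ⊓ W.map f = ⊥ := (h.mono hU hW).eq_bot
  rw [Submodule.map_sup, ← Submodule.finrank_sup_add_finrank_inf_eq, hd, finrank_bot, add_zero]

/-- An inequality between the dimensions of the images of two elements of the Terwilliger algebra
holds on every module if it holds on the irreducible ones. -/
theorem IsTModule.finrank_map_le {x : X} {B C : Matrix X X ℂ} (hB : B ∈ Y.terwilligerAlgebra x)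
    (hC : C ∈ Y.terwilligerAlgebra x)
    (hirr : ∀ W, Y.IsIrreducibleTModule x W →
      Module.finrank ℂ (W.map (toLin' B)) ≤ Module.finrank ℂ (W.map (toLin' C)))
    {U : Submodule ℂ (X → ℂ)} (hU : Y.IsTModule x U) :
    Module.finrank ℂ (U.map (toLin' B)) ≤ Module.finrank ℂ (U.map (toLin' C)) := by
  have hmap : ∀ {W : Submodule ℂ (X → ℂ)}, Y.IsTModule x W → ∀ {B : Matrix X X ℂ},
      B ∈ Y.terwilligerAlgebra x → W.map (toLin' B) ≤ W := by
    rintro W hW B hB _ ⟨w, hw, rfl⟩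
    exact hW B hB w hw
  induction hn : Module.finrank ℂ U using Nat.strong_induction_on generalizing U with
  | _ n ih =>
    by_cases h0 : U = ⊥
    · subst h0
      rw [Submodule.map_bot, Submodule.map_bot]
    obtain ⟨W, hWU, hW⟩ := exists_isIrreducibleTModule_le hU h0
    obtain ⟨W', hW', hc⟩ := hW.1.exists_isCompl
    have hT : Y.IsTModule x (W' ⊓ U) := fun B hB w hw => ⟨hW' B hB w hw.1, hU B hB w hw.2⟩
    -- By modularity, a complement of `W` in `V` cuts out a complement in `U`.
    have hsup : W ⊔ W' ⊓ U = U := by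
      rw [← sup_inf_assoc_of_le W' hWU, hc.sup_eq_top, top_inf_eq]
    have hdis : Disjoint W (W' ⊓ U) := hc.disjoint.mono_right inf_le_left
    have hlt : W' ⊓ U < U := by
      refine lt_of_le_of_ne inf_le_right fun heq => hW.2.1 ?_
      rw [heq] at hdis
      exact hdis.eq_bot_of_le hWU
    have h1 := ih _ (hn ▸ Submodule.finrank_lt_finrank_of_lt hlt) hT rfl
    rw [← hsup, finrank_map_sup _ (hmap hW.1 hB) (hmap hT hB) hdis,
      finrank_map_sup _ (hmap hW.1 hC) (hmap hT hC) hdis]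
    exact add_le_add (hirr W hW) h1

variable {q : Fin (D + 1) → Fin (D + 1) → Fin (D + 1) → ℂ}

/-- In a `Q`-polynomial scheme, a `T(x)`-module not annihilated by `E i` is not annihilated by
some `E k` with `D - i ≤ k`. -/
theorem IsPrimitiveIdempotents.exists_ge_mulVec_ne_zero (hE : Y.IsPrimitiveIdempotents E)
    (hq : IsKreinParameters E q) (hD : 0 < D)
    (hzero : ∀ h i j : Fin (D + 1), (h : ℕ) > i + j → q h i j = 0)
    (hne : ∀ h i j : Fin (D + 1), (h : ℕ) = i + j → q h i j ≠ 0)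
    {x : X} {W : Submodule ℂ (X → ℂ)} (hW : Y.IsTModule x W) {i : Fin (D + 1)} {v : X → ℂ}
    (hv : v ∈ W) (hi : E i *ᵥ v ≠ 0) :
    ∃ k : Fin (D + 1), D ≤ k + i ∧ ∃ u ∈ W, E k *ᵥ u ≠ 0 := by
  classical
  by_contra! hcon
  refine hi ?_
  set w := E i *ᵥ v with hw
  have hwW : w ∈ W := hW _ (hE.mem_terwilligerAlgebra x i) v hv
  ext y
  obtain ⟨j, hj, -⟩ := Y.R_partition x y
  have huW : Y.assocMatrix j x * w ∈ W := by
    rw [← dualIdempotent_mulVec]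
    exact hW _ (Algebra.subset_adjoin (Or.inr ⟨j, rfl⟩)) w hwW
  -- The part `E_j^* w` of `w` on `R_j(x)` has only components with `k + i < D`, and `star w` lies
  -- in `E_i V`, so `E_D` kills their product. Its entry at `x` is `E_D(x,y)` times the squared norm
  -- of that part, since `E_D` is constant on `R_j`.
  have h1 : E (Fin.last D) *ᵥ ((Y.assocMatrix j x * w) * star w) = 0 := by
    rw [← hE.sum_mulVec (Y.assocMatrix j x * w), Finset.sum_mul, mulVec_sum]
    refine Finset.sum_eq_zero fun k _ => ?_
    by_cases hk : D ≤ k + i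
    · rw [hcon k hk _ huW, zero_mul, mulVec_zero]
    · rw [hw, ← hE.mulVec_star]
      exact hE.mulVec_mul_eq_zero hq (hzero _ _ _ (by simp; omega)) _ _
  have h2 := congrFun h1 x
  rw [mulVec, dotProduct, Pi.zero_apply] at h2
  have h3 : ∀ z, E (Fin.last D) x z * ((Y.assocMatrix j x * w) * star w) z =
      E (Fin.last D) x y * (if Y.R j x z then w z * star (w z) else 0) := by
    intro z
    by_cases hz : Y.R j x z
    · simp [assocMatrix, hz, apply_eq_of_mem_boseMesner (hE.mem_boseMesner _) hz hj]
    · simp [assocMatrix, hz]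
  rw [Finset.sum_congr rfl fun z _ => h3 z, ← Finset.mul_sum] at h2
  have h4 := (mul_eq_zero.1 h2).resolve_left
    (hE.last_apply_ne_zero hq hD (fun h i => hzero h i ⟨1, by omega⟩) (fun h i => hne h i ⟨1, by omega⟩) x y)
  rw [Finset.sum_eq_zero_iff_of_nonneg] at h4
  · simpa [hj] using h4 y (Finset.mem_univ y)
  · intro z _
    split_ifs
    · exact mul_star_self_nonneg _
    · exact le_rfl

/-- The set of indices `i` such that `E i W ≠ 0` is an interval, if `W` is irreducible. -/
theorem IsPrimitiveIdempotents.exists_mulVec_ne_zero_of_between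
    (hE : Y.IsPrimitiveIdempotents E)
    (hq : IsKreinParameters E q) (hD : 0 < D)
    (hzero : ∀ h i j : Fin (D + 1), (h : ℕ) > i + j → q h i j = 0)
    (hne : ∀ h i j : Fin (D + 1), (h : ℕ) = i + j → q h i j ≠ 0)
    {x : X} {W : Submodule ℂ (X → ℂ)} (hW : Y.IsIrreducibleTModule x W) {i k l : Fin (D + 1)}
    (hik : i < k) (hkl : k ≤ l) (hi : ∃ u ∈ W, E i *ᵥ u ≠ 0) (hl : ∃ u ∈ W, E l *ᵥ u ≠ 0) :
    ∃ u ∈ W, E k *ᵥ u ≠ 0 := by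
  by_contra! hcon
  -- The part of `W` supported below the supposed gap `k`. Multiplication by row `x` of `E_1` raises
  -- the index by at most one and so cannot cross the gap; thus `U` is a module, contradicting
  -- irreducibility.
  let U : Submodule ℂ (X → ℂ) := W ⊓ ⨅ h : Fin (D + 1), ⨅ _ : k ≤ h, LinearMap.ker (toLin' (E h))
  have hUmem : ∀ w, w ∈ U ↔ w ∈ W ∧ ∀ h, k ≤ h → E h *ᵥ w = 0 := by
    intro w
    simp [U, Submodule.mem_iInf]
  have hUA : ∀ j, ∀ w ∈ U, Y.assocMatrix j *ᵥ w ∈ U := by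
    intro j w hw
    rw [hUmem] at hw ⊢
    refine ⟨hW.1 _ (Algebra.subset_adjoin (Or.inl ⟨j, rfl⟩)) w hw.1, fun h hh => ?_⟩
    obtain ⟨c, hc⟩ := hE.exists_coeff (B := Y.assocMatrix j) (Submodule.subset_span ⟨j, rfl⟩)
    rw [mulVec_mulVec, ← hc, hE.mul_sum_smul, smul_mulVec, hw.2 h hh, smul_zero]
  have hWrow : ∀ B ∈ Y.boseMesner, ∀ w ∈ W, B x * w ∈ W := by
    intro B hB w hw
    induction hB using Submodule.span_induction with
    | mem B hB =>
      obtain ⟨j, rfl⟩ := hB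
      rw [← dualIdempotent_mulVec]
      exact hW.1 _ (Algebra.subset_adjoin (Or.inr ⟨j, rfl⟩)) w hw
    | zero =>
      have h0 : (0 : Matrix X X ℂ) x * w = 0 := zero_mul w
      rw [h0]
      exact W.zero_mem
    | add B C _ _ hB hC =>
      have h0 : (B + C) x * w = B x * w + C x * w := add_mul _ _ _
      rw [h0]
      exact W.add_mem hB hC
    | smul c B _ hB =>
      have h0 : (c • B) x * w = c • (B x * w) := smul_mul_assoc c (B x) w
      rw [h0]
      exact W.smul_mem _ hB
  have hrow : E ⟨1, by omega⟩ x = E ⟨1, by omega⟩ *ᵥ Pi.single x 1 := by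
    ext y
    rw [mulVec_single_one, col_apply, ← transpose_apply (E _), hE.transpose_eq]
  have hU1 : ∀ w ∈ U, E ⟨1, by omega⟩ x * w ∈ U := by
    intro w hw
    rw [hUmem] at hw ⊢
    have hmem := hWrow _ (hE.mem_boseMesner ⟨1, by omega⟩) w hw.1
    refine ⟨hmem, fun h hh => ?_⟩
    rcases eq_or_lt_of_le hh with rfl | hlt
    · exact hcon _ hmem
    rw [← hE.sum_mulVec w, Finset.mul_sum, mulVec_sum]
    refine Finset.sum_eq_zero fun m _ => ?_
    by_cases hm : k ≤ m
    · rw [hw.2 m hm, mul_zero, mulVec_zero]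
    · rw [hrow]
      refine hE.mulVec_mul_eq_zero hq (hzero _ _ _ ?_) _ _
      have h1 : (k : ℕ) < h := hlt
      have h2 : (m : ℕ) < k := not_le.1 hm
      simp only
      omega
  have hUT : Y.IsTModule x U := by
    refine isTModule_of_generators hUA fun j w hw => ?_
    rw [dualIdempotent_mulVec]
    -- The multipliers preserving `U`; they contain every `A_j` row once they absorb the row of
    -- `E_1`.
    let S : Submodule ℂ (X → ℂ) :=
      { carrier := {f | ∀ w ∈ U, f * w ∈ U}
        add_mem' := fun {f g} hf hg w hw => by
          rw [add_mul]
          exact U.add_mem (hf w hw) (hg w hw)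
        zero_mem' := fun w _ => by
          rw [zero_mul]
          exact U.zero_mem
        smul_mem' := fun c f hf w hw => by
          rw [smul_mul_assoc]
          exact U.smul_mem _ (hf w hw) }
    refine hE.assocMatrix_row_mem hq hD (fun h i => hzero h i ⟨1, by omega⟩) (fun h i => hne h i ⟨1, by omega⟩) x S
      (fun w hw => ?_) (fun f hf w hw => ?_) j w hw
    · rw [one_mul]
      exact hw
    · rw [mul_assoc]
      exact hU1 _ (hf w hw)
  rcases hW.2.2 U inf_le_left hUT with h | h
  · obtain ⟨u, hu, hne⟩ := hi
    refine hne ?_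
    have : E i *ᵥ u ∈ U := by
      rw [hUmem]
      refine ⟨hW.1 _ (hE.mem_terwilligerAlgebra x i) u hu, fun h hh => ?_⟩
      rw [mulVec_mulVec, hE.mul_of_ne (hik.trans_le hh).ne', zero_mulVec]
    rw [h] at this
    exact (Submodule.mem_bot ℂ).1 this
  · obtain ⟨u, hu, hne⟩ := hl
    rw [← h, hUmem] at hu
    exact hne (hu.2 l hkl)

end Modules

end Idempotents

end SymmAssocScheme

/-! ### The multiplicity inequalities -/

theorem mainTheorem1 {X : Type*} [Fintype X] [DecidableEq X] {D : ℕ}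
    (Y : SymmAssocScheme X D) (E : Fin (D + 1) → Matrix X X ℂ)
    (hQ : Y.IsQPolynomial E) (hthin : Y.IsDualThin E) :
    ∀ (i : ℕ) (hi : 2 * i < D),
      schemeMultiplicity E ⟨i, by omega⟩ ≤ schemeMultiplicity E ⟨i + 1, by omega⟩ ∧
      schemeMultiplicity E ⟨i, by omega⟩ ≤ schemeMultiplicity E ⟨D - i, by omega⟩ := by
  obtain ⟨hE, q, hq, hpoly⟩ := hQ
  intro i hi
  obtain ⟨x⟩ := Y.nonempty
  have hzero : ∀ h i j : Fin (D + 1), (h : ℕ) > i + j → q h i j = 0 :=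
    fun h i j hh => (hpoly h i j).1 (Or.inl hh)
  have hne : ∀ h i j : Fin (D + 1), (h : ℕ) = i + j → q h i j ≠ 0 :=
    fun h i j hh => (hpoly h i j).2 (Or.inl hh)
  -- Since `2 * i < D`, this range contains both `i + 1` and `D - i`.
  have key : ∀ k : Fin (D + 1), i < k → (k : ℕ) ≤ D - i →
      schemeMultiplicity E ⟨i, by omega⟩ ≤ schemeMultiplicity E k := by
    intro k hik hkD
    have hle := SymmAssocScheme.IsTModule.finrank_map_le (U := ⊤)
      (hE.mem_terwilligerAlgebra x ⟨i, by omega⟩) (hE.mem_terwilligerAlgebra x k) ?_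
      (fun _ _ _ _ => Submodule.mem_top)
    · rwa [Submodule.map_top, Submodule.map_top] at hle
    intro W hW
    by_cases hW0 : ∃ u ∈ W, E ⟨i, by omega⟩ *ᵥ u ≠ 0
    · refine (hthin x W hW _).trans ?_
      obtain ⟨v, hv, hvi⟩ := hW0
      obtain ⟨l, hl, hlW⟩ := hE.exists_ge_mulVec_ne_zero hq (by omega) hzero hne hW.1 hv hvi
      obtain ⟨u, hu, huk⟩ := hE.exists_mulVec_ne_zero_of_between hq (by omega) hzero hne hW
        (i := ⟨i, by omega⟩) (k := k) (l := l) hik (Fin.le_def.2 (by simp at hl; omega))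
        ⟨v, hv, hvi⟩ hlW
      rw [Submodule.one_le_finrank_iff]
      exact (Submodule.ne_bot_iff _).2 ⟨_, ⟨u, hu, rfl⟩, huk⟩
    · push Not at hW0
      have h0 : W.map (Matrix.toLin' (E ⟨i, by omega⟩)) = ⊥ := by
        rw [← LinearMap.le_ker_iff_map]
        exact fun u hu => hW0 u hu
      rw [h0, finrank_bot]
      exact Nat.zero_le _
  exact ⟨key ⟨i + 1, by omega⟩ (by simp) (by simp; omega),
    key ⟨D - i, by omega⟩ (by simp; omega) (by simp)⟩
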